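/- Write $\mathbb{R}^{2,1}$ with coordinates $(x,y,t)$, $u=\tfrac12(t+y)$, $v=\tfrac12(t-y)$, so that $\partial_u=\partial_t+\partial_y$ and $\partial_v=\partial_t-\partial_y$. An extended uniton with pole data $(i,k)$ is a map $\phi(x,y,\lambda)$ with values in the complex $n\times n$ matrices, independent of $t$, such that: (a) $\phi$ is rational in $\lambda$, $\phi(x,y,\infty)=\mathrm{I}$, and its only pole is $\lambda=i$, of multiplicity $k$; that is, $\phi=\mathrm{I}+\sum_{j=1}^k C_j(x,y)(\lambda-i)^{-j}$ with $C_k\not\equiv 0$; (b) on $\lambda\neq\pm i$, $\phi$ is smooth with values in $GL(n,\mathbb{C})$, satisfies $\phi(x,y,\bar\lambda)^*\phi(x,y,\lambda)=\mathrm{I}$, and $(\lambda\phi_x-\phi_u)\phi^{-1}$ and $(\lambda\phi_v-\phi_x)\phi^{-1}$ are independent of $\lambda$; (c) $J=\phi(\cdot,0)^{-1}$ has finite energy $\tfrac12\iint \|J^{-1}J_t\|^2+\|J^{-1}J_x\|^2+\|J^{-1}J_y\|^2\,dx\,dy<\infty$, where $\|\xi\|^2=-\mathrm{tr}(\xi^2)$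 (and $J_t=0$ here). For a Hermitian projection $\pi$ of $\mathbb{C}^n$ let $\pi^\perp=\mathrm{I}-\pi$ and $g_{i,\pi}(\lambda)=\pi+\frac{\lambda+i}{\lambda-i}\,\pi^\perp$. A factorization $$\phi=g_{i,\pi_k}\cdots g_{i,\pi_1},$$ with $\pi_1,\dots,\pi_k$ smooth maps from $\mathbb{R}^2$ to the Hermitian projections of $\mathbb{C}^n$, is called minimal if, at the points $(x,y)$ of a dense subset of $\mathbb{R}^2$ (for instance at every point, or at all but finitely many), $\pi_j\neq 0,\mathrm{I}$ for $1\le j\le k$ and $\mathrm{Im}\,\pi_j\cap\mathrm{Im}\,\pi_{j-1}^\perp=0$ for $2\le j\le k$. **Proposition.** Let $\phi$ be an extended uniton with pole data $(i,k)$ and let $\phi=g_{i,\pi_k}\cdots g_{i,\pi_1}$ be a minimal factorization. Suppose that no nonzero constant vector $c\in\mathbb{C}^n$ satisfies $c\in\mathrm{Im}\,\pi_1(x,y)$ for all $(x,y)$. Then each $\pi_j$ has constant rank $m_j$, and $$m_1>m_2>\cdots>m_k.$$ -/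

import Mathlib

open scoped ContDiff ComplexConjugate

noncomputable section

namespace Ward

/-- Complex `n × n` matrices. -/
abbrev Mat (n : ℕ) : Type := Matrix (Fin n) (Fin n) ℂ

/-- Space-time `ℝ^{2,1}` with the standard variables `(x, y, t)`. -/
abbrev SpaceTime : Type := ℝ × ℝ × ℝ

/-- The derivative at `p`, in the direction `e`, of a matrix valued map (entry by entry). -/
def dirDeriv {E : Type*} [NormedAddCommGroup E] [NormedSpace ℝ E] {n : ℕ}
    (e : E) (F : E → Mat n) (p : E) : Mat n :=
  Matrix.of fun a b => fderiv ℝ (fun q => F q a b) p e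

/-- The coordinate vectors of `x`, `y`, `t`. -/
def ex : SpaceTime := (1, 0, 0)
def ey : SpaceTime := (0, 1, 0)
def et : SpaceTime := (0, 0, 1)

/-- The vectors of `∂_u = ∂_t + ∂_y` and `∂_v = ∂_t - ∂_y`, where
`u = (t + y) / 2` and `v = (t - y) / 2`, that is `y = u - v` and `t = u + v`. -/
def eu : SpaceTime := et + ey
def ev : SpaceTime := et - ey

/-- `ψ(x, y, t, ζ)` is an extended solution of the Ward equation on `ℝ^{2,1} × Ω`, with `Ω` an open
neighbourhood of `0` in `ℂ`: it is smooth with values in `GL(n, ℂ)`, it solves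
`(ζ ∂_x - ∂_u) ψ = A ψ` and `(ζ ∂_v - ∂_x) ψ = B ψ` with `A`, `B` independent of the spectral
parameter `ζ`, and it satisfies the `U(n)`-reality condition. -/
structure IsExtendedSolution {n : ℕ} (Ω : Set ℂ) (ψ : SpaceTime → ℂ → Mat n) : Prop where
  isOpen : IsOpen Ω
  zero_mem : (0 : ℂ) ∈ Ω
  smooth : ∀ a b : Fin n,
    ContDiffOn ℝ ∞ (fun q : SpaceTime × ℂ => ψ q.1 q.2 a b) (Set.univ ×ˢ Ω)
  invertible : ∀ p, ∀ ζ ∈ Ω, IsUnit (ψ p ζ)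
  lax : ∃ A B : SpaceTime → Mat n, ∀ p, ∀ ζ ∈ Ω,
    ζ • dirDeriv ex (fun q => ψ q ζ) p - dirDeriv eu (fun q => ψ q ζ) p = A p * ψ p ζ ∧
    ζ • dirDeriv ev (fun q => ψ q ζ) p - dirDeriv ex (fun q => ψ q ζ) p = B p * ψ p ζ
  reality : ∀ p, ∀ ζ ∈ Ω, conj ζ ∈ Ω → (ψ p (conj ζ)).conjTranspose * ψ p ζ = 1

/-- The Ward map `J = ψ(⋅, 0)⁻¹` of an extended solution. -/
def wardMap {n : ℕ} (ψ : SpaceTime → ℂ → Mat n) (p : SpaceTime) : Mat n := (ψ p 0)⁻¹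

/-- `‖ξ‖² = -tr(ξ²)`, a nonnegative real number for skew-Hermitian `ξ`. -/
def normSqU {n : ℕ} (ξ : Mat n) : ℝ := (-(ξ * ξ).trace).re

/-- The energy `½ ∬ ‖J⁻¹J_t‖² + ‖J⁻¹J_x‖² + ‖J⁻¹J_y‖² dx dy` of `J` at time `t`. -/
def energy {n : ℕ} (J : SpaceTime → Mat n) (t : ℝ) : ENNReal :=
  ∫⁻ q : ℝ × ℝ, ENNReal.ofReal (1 / 2 *
    (normSqU ((J (q.1, q.2, t))⁻¹ * dirDeriv et J (q.1, q.2, t)) +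
     normSqU ((J (q.1, q.2, t))⁻¹ * dirDeriv ex J (q.1, q.2, t)) +
     normSqU ((J (q.1, q.2, t))⁻¹ * dirDeriv ey J (q.1, q.2, t))))

/-- `ψ` is rational in `ζ`, tends to the identity as `ζ → ∞`, and has its only pole at `ζ = z`, of
multiplicity `k`: by partial fractions, `ψ = I + ∑_{1 ≤ j ≤ k} C_j / (ζ - z)^j` with `C_k ≢ 0`. -/
def HasPoleData {X : Type*} {n : ℕ} (z : ℂ) (k : ℕ) (ψ : X → ℂ → Mat n) : Prop :=
  ∃ C : ℕ → X → Mat n, (∀ p, C 0 p = 1) ∧ (∃ p, C k p ≠ 0) ∧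
    ∀ p, ∀ ζ : ℂ, ζ ≠ z → ψ p ζ = ∑ j ∈ Finset.range (k + 1), ((ζ - z) ^ j)⁻¹ • C j p

/-- `ψ` is an extended Ward soliton with pole data `(z, k)`. -/
structure IsExtendedSoliton {n : ℕ} (z : ℂ) (k : ℕ) (ψ : SpaceTime → ℂ → Mat n) : Prop where
  extendedSolution : IsExtendedSolution {ζ : ℂ | ζ ≠ z ∧ ζ ≠ conj z} ψ
  poleData : HasPoleData z k ψ
  finiteEnergy : ∀ t : ℝ, energy (wardMap ψ) t < ⊤

/-- An extended uniton with pole data `(i, k)`: a map `φ(x, y, ζ)` which, regarded as a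
map of `(x, y, t, ζ)` that does not depend on `t`, is an extended Ward soliton with pole data
`(i, k)`. Its Ward map is then a harmonic map of finite energy from `ℝ²` to `U(n)`. -/
def IsExtendedUniton {n : ℕ} (k : ℕ) (φ : ℝ × ℝ → ℂ → Mat n) : Prop :=
  IsExtendedSoliton Complex.I k (fun p : SpaceTime => φ (p.1, p.2.1))

/-- Hermitian projections of `ℂ^n`. -/
def IsHermitianProjection {n : ℕ} (P : Mat n) : Prop := P.IsHermitian ∧ P * P = P

/-- The image of a matrix, as a subspace of `ℂ^n`. -/
def im {n : ℕ} (P : Mat n) : Submodule ℂ (Fin n → ℂ) := LinearMap.range P.mulVecLin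

/-- The simple element `g_{z,P}(ζ) = P + (ζ - z̄) / (ζ - z) P^⊥`, with `P^⊥ = I - P`. -/
def simpleElement {n : ℕ} (z : ℂ) (P : Mat n) (ζ : ℂ) : Mat n :=
  P + ((ζ - conj z) / (ζ - z)) • (1 - P)

/-- The product `g_{z,P_l}(ζ) ⋯ g_{z,P_1}(ζ)`. -/
def simpleProd {n : ℕ} (z : ℂ) (P : ℕ → Mat n) : ℕ → ℂ → Mat n
  | 0, _ => 1
  | l + 1, ζ => simpleElement z (P (l + 1)) ζ * simpleProd z P l ζ

/-- `f = ((ζ - z̄) / (ζ - z))^{k - l} g_{z,P_l} ⋯ g_{z,P_1}` is a minimal factorization: the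
Hermitian projections `P_1, …, P_l` are different from `0` and `I`, and
`Im P_j ∩ Im P_{j-1}^⊥ = 0` for `2 ≤ j ≤ l`. -/
structure IsMinimalFactorization {n : ℕ} (z : ℂ) (k l : ℕ) (P : ℕ → Mat n) (f : ℂ → Mat n) :
    Prop where
  le : l ≤ k
  proj : ∀ j ∈ Set.Icc 1 l, IsHermitianProjection (P j) ∧ P j ≠ 0 ∧ P j ≠ 1
  inf_eq_bot : ∀ j ∈ Set.Icc 2 l, im (P j) ⊓ im (1 - P (j - 1)) = ⊥
  eq_prod : ∀ ζ : ℂ, ζ ≠ z →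
    f ζ = ((ζ - conj z) / (ζ - z)) ^ (k - l) • simpleProd z P l ζ

/-- `φ = g_{z,π_k} ⋯ g_{z,π_1}` is a minimal factorization of the map `φ` on `ℝ²`: the `π_j` are
smooth maps from `ℝ²` to the Hermitian projections, and the factorization is minimal at the points
of a dense set (at the exceptional points `Im π_j` may meet `Im π_{j-1}^⊥`). -/
structure IsMinimalFactorizationMap {n : ℕ} (z : ℂ) (k : ℕ) (π : ℕ → ℝ × ℝ → Mat n)
    (φ : ℝ × ℝ → ℂ → Mat n) : Prop where
  smooth : ∀ j ∈ Set.Icc 1 k, ∀ a b : Fin n, ContDiff ℝ ∞ (fun p => π j p a b)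
  proj : ∀ j ∈ Set.Icc 1 k, ∀ p, IsHermitianProjection (π j p)
  minimal : Dense {p | IsMinimalFactorization z k k (fun j => π j p) (φ p)}

end Ward

end

noncomputable section

namespace Ward

/-! Put `μ = (λ + i)/(λ - i)`, so that `φ` is a polynomial in `μ`, and combine the two linear
equations into `2∂_z φ = (μ - 1) P φ` with `P` independent of `μ`. The information lies at `μ = 0`,
where the product degenerates to `T_l = π_l ⋯ π_1`. There the equation yields `π_k P = 0` and `(2∂_z
π_k + P) π_k = 0`, which are exactly what is needed to strip off the last factor and keep an
equation of the same form (`IsLax.pred`). Hence every partial product solves such an equation; its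
coefficient `P_l` kills `Im π_{l+1}`, and `Im π_1` is a holomorphic subbundle.

The trace of a projection is its rank, so ranks are constant on the connected plane, and `Im π_{l+1}
∩ Im π_l^⊥ = 0` gives `m_{l+1} ≤ m_l`. Suppose equality holds. At a point `p₀` where the
factorization is minimal, `π_{l+1} π_l + π_{l+1}^⊥ π_l^⊥` is then invertible, and remains so nearby.
Together with `π_{l+1} ∂_z̄ T_l = 0` this makes `∂_z̄ T_l` a left multiple of `T_l`, as `∂_z T_l`
already is (`exists_wirt_projProd_eq`). By Grönwall, `ker T_l` is locally constant. Since it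
contains `ker π_1`, the columns of `T_l(p₀)^*` lie in `Im π_1` near `p₀`, and by unique continuation
(`mul_eq_self_of_eventually`) everywhere. They are therefore zero, which forces `π_l(p₀) = 0` and
contradicts minimality. -/

theorem isUnit_imp_eq_zero {𝔸 : Type*} [MonoidWithZero 𝔸] {a x : 𝔸} (ha : IsUnit a)
    (h : a * x = 0) : x = 0 := by
  obtain ⟨u, rfl⟩ := ha
  exact (Units.mul_right_eq_zero u).1 h

/-! ### Wirtinger derivatives of algebra-valued maps of the plane. -/

section WirtingerOperator

variable {𝔸 : Type*} [NormedRing 𝔸] [NormedAlgebra ℂ 𝔸]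

/-- The operator `∂_x + w ∂_y` on maps of the plane: `2 ∂_z` for `w = -i`, `2 ∂_{z̄}` for
`w = i`. -/
def wirt (w : ℂ) (F : ℝ × ℝ → 𝔸) (p : ℝ × ℝ) : 𝔸 :=
  fderiv ℝ F p (1, 0) + w • fderiv ℝ F p (0, 1)

theorem wirt_mul {F G : ℝ × ℝ → 𝔸} {p : ℝ × ℝ} (w : ℂ) (hF : DifferentiableAt ℝ F p)
    (hG : DifferentiableAt ℝ G p) :
    wirt w (fun q => F q * G q) p = wirt w F p * G p + F p * wirt w G p := by
  simp only [wirt, fderiv_fun_mul' hF hG, add_apply,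
    smul_apply, smul_eq_mul, MulOpposite.smul_eq_mul_unop,
    MulOpposite.unop_op, smul_add, add_mul, mul_add, smul_mul_assoc, mul_smul_comm]
  abel

theorem wirt_const (w : ℂ) (c : 𝔸) (p : ℝ × ℝ) : wirt w (fun _ => c) p = 0 := by
  simp [wirt]

theorem wirt_congr {F G : ℝ × ℝ → 𝔸} {p : ℝ × ℝ} (w : ℂ) (h : F =ᶠ[nhds p] G) :
    wirt w F p = wirt w G p := by
  simp only [wirt, h.fderiv_eq]

theorem wirt_simple {F : ℝ × ℝ → 𝔸} {p : ℝ × ℝ} (w μ : ℂ) (hF : DifferentiableAt ℝ F p) :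
    wirt w (fun q => F q + μ • (1 - F q)) p = (1 - μ) • wirt w F p := by
  have h : DifferentiableAt ℝ (fun q => μ • (1 - F q)) p := (hF.const_sub 1).const_smul μ
  simp only [wirt, fderiv_fun_add hF h, fderiv_fun_const_smul (hF.const_sub 1) μ, fderiv_const_sub,
    add_apply, smul_apply, neg_apply,
    sub_smul, one_smul, smul_neg, smul_add, smul_comm μ w]
  abel

theorem continuous_wirt {F : ℝ × ℝ → 𝔸} (w : ℂ) (hF : ContDiff ℝ ∞ F) :
    Continuous (wirt w F) := by
  have h : Continuous (fderiv ℝ F) := hF.continuous_fderiv (by simp)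
  unfold wirt
  fun_prop

theorem wirt_star [StarRing 𝔸] [StarModule ℂ 𝔸] [ContinuousStar 𝔸] {F : ℝ × ℝ → 𝔸}
    {p : ℝ × ℝ} (w : ℂ) :
    wirt w (fun q => star (F q)) p = star (wirt (conj w) F p) := by
  have : StarModule ℝ 𝔸 := ⟨fun r a => by
    rw [← Complex.coe_smul, star_smul, ← Complex.coe_smul]; simp⟩
  simp [wirt, fderiv_star]

theorem fderiv_eq_wirt (F : ℝ × ℝ → 𝔸) (p v : ℝ × ℝ) :
    fderiv ℝ F p v = ((v.1 / 2 - v.2 * Complex.I / 2 : ℂ)) • wirt Complex.I F p +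
      ((v.1 / 2 + v.2 * Complex.I / 2 : ℂ)) • wirt (-Complex.I) F p := by
  have h : v = v.1 • ((1, 0) : ℝ × ℝ) + v.2 • ((0, 1) : ℝ × ℝ) := by ext <;> simp
  conv_lhs => rw [h, map_add, map_smul, map_smul]
  simp only [wirt, smul_add, smul_smul, ← Complex.coe_smul]
  generalize fderiv ℝ F p (1, 0) = X
  generalize fderiv ℝ F p (0, 1) = Y
  have e : ((v.1 / 2 - v.2 * Complex.I / 2 : ℂ)) • X +
      ((v.1 / 2 - v.2 * Complex.I / 2 : ℂ) * Complex.I) • Y +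
      (((v.1 / 2 + v.2 * Complex.I / 2 : ℂ)) • X +
      ((v.1 / 2 + v.2 * Complex.I / 2 : ℂ) * -Complex.I) • Y) =
      ((v.1 / 2 - v.2 * Complex.I / 2 : ℂ) + (v.1 / 2 + v.2 * Complex.I / 2)) • X +
      ((v.1 / 2 - v.2 * Complex.I / 2 : ℂ) * Complex.I +
        (v.1 / 2 + v.2 * Complex.I / 2) * -Complex.I) • Y := by
    simp only [add_smul]; abel
  rw [e]
  congr 2
  · ring
  · linear_combination (v.2 : ℂ) * Complex.I_mul_I

end WirtingerOperator

/-! ### Holomorphic subbundles and the identity theorem. -/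

section UniqueContinuation

variable {𝔸 : Type*} [NormedRing 𝔸] [NormedAlgebra ℂ 𝔸]

theorem differentiableAt_of_wirt_eq_zero {F : ℝ × ℝ → 𝔸} {z : ℂ}
    (hF : DifferentiableAt ℝ F (z.re, z.im)) (h : wirt Complex.I F (z.re, z.im) = 0) :
    DifferentiableAt ℂ (fun ζ : ℂ => F (ζ.re, ζ.im)) z := by
  have hF' : HasFDerivAt F (fderiv ℝ F (z.re, z.im)) (Complex.equivRealProdCLM z) :=
    hF.hasFDerivAt
  have hc : HasFDerivAt (fun ζ : ℂ => F (ζ.re, ζ.im)) _ z :=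
    hF'.comp z Complex.equivRealProdCLM.hasFDerivAt
  rw [differentiableAt_complex_iff_differentiableAt_real]
  refine ⟨hc.differentiableAt, ?_⟩
  rw [hc.fderiv]
  simp only [ContinuousLinearMap.comp_apply, ContinuousLinearEquiv.coe_coe,
    Complex.equivRealProdCLM_apply, Complex.I_re, Complex.I_im, Complex.one_re, Complex.one_im]
  unfold wirt at h
  rw [eq_neg_of_add_eq_zero_left h, smul_neg, smul_smul, Complex.I_mul_I, neg_smul, one_smul,
    neg_neg]

variable [CompleteSpace 𝔸]

/-- Unique continuation for constant sections of a holomorphic subbundle. -/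
theorem mul_eq_self_of_eventually {Q : ℝ × ℝ → 𝔸} (hQ : ContDiff ℝ ∞ Q)
    (hid : ∀ p, Q p * Q p = Q p) (hol : ∀ p, wirt Complex.I Q p * Q p = 0) {c : 𝔸}
    {p₀ : ℝ × ℝ} (h₀ : ∀ᶠ p in nhds p₀, Q p * c = c) (p : ℝ × ℝ) : Q p * c = c := by
  set S : Set (ℝ × ℝ) := interior {p | Q p * c = c} with hS
  have hSc : ∀ r ∈ S, Q r * c = c := fun r hr => interior_subset (s := {p | Q p * c = c}) hr
  have hcl : IsClosed S := by
    -- Near a limit point `q`, the map `N` intertwines `Q r` with `Q q` and equals `1` at `q`. So `R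
    -- = N⁻¹ Q(q)` is a local frame of the image of `Q`, normalized by `Q(q) R = Q(q)`.
    refine isClosed_of_closure_subset fun q hq => ?_
    set N : ℝ × ℝ → 𝔸 := fun r => Q q * Q r + (1 - Q q) * (1 - Q r) with hN
    have hNd : Differentiable ℝ N := by
      have := hQ.differentiable (by simp)
      fun_prop
    have hNq : N q = 1 := by
      simp only [hN, sub_mul, mul_sub, hid, one_mul, mul_one]; abel
    have hU : ∀ᶠ r in nhds q, IsUnit (N r) :=
      hNd.continuous.continuousAt.eventually
        (Units.isOpen.mem_nhds (by rw [Set.mem_ofPred_eq, hNq]; exact isUnit_one))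
    obtain ⟨ε, hε, hball⟩ := Metric.eventually_nhds_iff_ball.1 hU
    set R : ℝ × ℝ → 𝔸 := fun r => Ring.inverse (N r) * Q q with hR
    have hRd : ∀ r ∈ Metric.ball q ε, DifferentiableAt ℝ R r := fun r hr =>
      (((differentiableAt_inverse (𝕜 := ℝ) (hball r hr)).comp r (hNd r)).mul
        (differentiableAt_const _))
    have hNR : ∀ r ∈ Metric.ball q ε, N r * R r = Q q := fun r hr => by
      rw [hR]; simp only [← mul_assoc]; rw [Ring.mul_inverse_cancel _ (hball r hr), one_mul]
    have hcomm : ∀ r, N r * Q r = Q q * N r := fun r => by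
      simp only [hN, add_mul, mul_add, sub_mul, mul_sub, mul_assoc, hid, one_mul, mul_one]
      simp only [← mul_assoc, hid]; abel
    have hQR : ∀ r ∈ Metric.ball q ε, Q r * R r = R r := fun r hr => by
      rw [← sub_eq_zero]
      refine isUnit_imp_eq_zero (hball r hr) ?_
      rw [mul_sub, ← mul_assoc, hcomm, mul_assoc, hNR r hr, hid, sub_self]
    have hqR : ∀ r ∈ Metric.ball q ε, Q q * R r = Q q := fun r hr => by
      have := hNR r hr
      simp only [hN, add_mul, mul_assoc, sub_mul (1 : 𝔸) (Q r), one_mul, hQR r hr, sub_self,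
        mul_zero, add_zero] at this
      exact this
    have hRiff : ∀ r ∈ Metric.ball q ε, (Q r * c = c ↔ R r * c - c = 0) := fun r hr => by
      rw [sub_eq_zero]
      constructor
      · intro h
        rw [← sub_eq_zero]
        refine isUnit_imp_eq_zero (hball r hr) ?_
        rw [mul_sub, ← mul_assoc, hNR r hr]
        simp only [hN, add_mul, mul_assoc, sub_mul (1 : 𝔸) (Q r), one_mul, h, sub_self, mul_zero,
          add_zero]
      · intro h
        rw [← h, ← mul_assoc, hQR r hr]
    -- The frame is holomorphic: `∂_z̄ R` lies in the image of `Q r` by holomorphy of the subbundle,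
    -- and is killed by `Q q` by the normalization; `N r` is therefore zero on it.
    have hwR : ∀ r ∈ Metric.ball q ε, wirt Complex.I R r = 0 := fun r hr => by
      have hnb : Metric.ball q ε ∈ nhds r := Metric.isOpen_ball.mem_nhds hr
      have h1 : wirt Complex.I R r = Q r * wirt Complex.I R r := by
        have e : wirt Complex.I R r = wirt Complex.I (fun s => Q s * R s) r :=
          wirt_congr _ (Filter.mem_of_superset hnb fun s hs => (hQR s hs).symm)
        rw [wirt_mul _ (hQ.differentiable (by simp) r) (hRd r hr)] at e
        have z : wirt Complex.I Q r * R r = 0 := by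
          rw [← hQR r hr, ← mul_assoc, hol, zero_mul]
        rwa [z, zero_add] at e
      have h2 : Q q * wirt Complex.I R r = 0 := by
        have e : wirt Complex.I (fun s => Q q * R s) r = wirt Complex.I (fun _ => Q q) r :=
          wirt_congr _ (Filter.mem_of_superset hnb fun s hs => hqR s hs)
        rw [wirt_mul _ (differentiableAt_const _) (hRd r hr), wirt_const] at e
        simpa using e
      refine isUnit_imp_eq_zero (hball r hr) ?_
      simp only [hN, add_mul, mul_assoc, sub_mul (1 : 𝔸) (Q r), one_mul, ← h1, h2, sub_self,
        mul_zero, add_zero]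
    set e : ℂ ≃L[ℝ] ℝ × ℝ := Complex.equivRealProdCLM
    set B : Set ℂ := e ⁻¹' Metric.ball q ε with hB
    have hBo : IsOpen B := Metric.isOpen_ball.preimage e.continuous
    have hBc : IsPreconnected B :=
      ((convex_ball q ε).linear_preimage (e : ℂ →ₗ[ℝ] ℝ × ℝ)).isPreconnected
    have hf : AnalyticOnNhd ℂ (fun ζ : ℂ => R (ζ.re, ζ.im) * c - c) B := by
      refine DifferentiableOn.analyticOnNhd (fun ζ hζ => ?_) hBo
      exact (((differentiableAt_of_wirt_eq_zero (hRd _ hζ) (hwR _ hζ)).mul_const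
        c).sub_const c).differentiableWithinAt
    obtain ⟨r, hr, hrS⟩ := mem_closure_iff.1 hq _ Metric.isOpen_ball (Metric.mem_ball_self hε)
    have hz : (fun ζ : ℂ => R (ζ.re, ζ.im) * c - c) =ᶠ[nhds (e.symm r)] 0 := by
      have hopen : IsOpen (e ⁻¹' (Metric.ball q ε ∩ S)) :=
        (Metric.isOpen_ball.inter isOpen_interior).preimage e.continuous
      refine Filter.mem_of_superset (hopen.mem_nhds ?_) fun ζ hζ => ?_
      · simpa using ⟨hr, hrS⟩
      · exact (hRiff _ hζ.1).1 (hSc _ hζ.2)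
    have hzero := hf.eqOn_zero_of_preconnected_of_eventuallyEq_zero hBc
      (z₀ := e.symm r) (by simpa [hB] using hr) hz
    refine mem_interior.2 ⟨Metric.ball q ε, fun s hs => ?_, Metric.isOpen_ball,
      Metric.mem_ball_self hε⟩
    have hs' := hzero (x := e.symm s) (by simpa [hB] using hs)
    exact (hRiff s hs).2 (by simpa [e] using hs')
  have huniv : S = Set.univ := IsClopen.eq_univ ⟨hcl, isOpen_interior⟩
    ⟨p₀, mem_interior_iff_mem_nhds.2 h₀⟩
  exact hSc p (huniv ▸ Set.mem_univ p)

end UniqueContinuation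

/-! ### Products of simple factors and their inverses, as polynomials in `μ`. -/

section Products

variable {𝔸 : Type*} [NormedRing 𝔸] [NormedAlgebra ℂ 𝔸]

/-- The product `(π_l + μ π_l^⊥) ⋯ (π_1 + μ π_1^⊥)`. -/
def projProd (π : ℕ → ℝ × ℝ → 𝔸) : ℕ → ℂ → ℝ × ℝ → 𝔸
  | 0, _, _ => 1
  | l + 1, μ, p => (π (l + 1) p + μ • (1 - π (l + 1) p)) * projProd π l μ p

/-- The product `(π_1 + μ π_1^⊥) ⋯ (π_l + μ π_l^⊥)` in the reversed order. -/
def projProdRev (π : ℕ → ℝ × ℝ → 𝔸) : ℕ → ℂ → ℝ × ℝ → 𝔸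
  | 0, _, _ => 1
  | l + 1, μ, p => projProdRev π l μ p * (π (l + 1) p + μ • (1 - π (l + 1) p))

variable {π : ℕ → ℝ × ℝ → 𝔸}

theorem contDiff_projProd (hπ : ∀ j, ContDiff ℝ ∞ (π j)) (l : ℕ) (μ : ℂ) :
    ContDiff ℝ ∞ (projProd π l μ) := by
  induction l with
  | zero => exact contDiff_const
  | succ l ih =>
    exact ((hπ (l + 1)).add ((contDiff_const.sub (hπ (l + 1))).const_smul μ)).mul ih

theorem contDiff_projProdRev (hπ : ∀ j, ContDiff ℝ ∞ (π j)) (l : ℕ) (μ : ℂ) :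
    ContDiff ℝ ∞ (projProdRev π l μ) := by
  induction l with
  | zero => exact contDiff_const
  | succ l ih =>
    exact ih.mul ((hπ (l + 1)).add ((contDiff_const.sub (hπ (l + 1))).const_smul μ))

theorem simple_mul_simple_inv {P : 𝔸} (hP : P * P = P) {μ : ℂ} (hμ : μ ≠ 0) :
    (P + μ • (1 - P)) * (P + μ⁻¹ • (1 - P)) = 1 := by
  have h1 : P * (1 - P) = 0 := by rw [mul_sub, mul_one, hP, sub_self]
  have h2 : (1 - P) * P = 0 := by rw [sub_mul, one_mul, hP, sub_self]
  have h3 : (1 - P) * (1 - P) = 1 - P := by rw [mul_sub, mul_one, h2, sub_zero]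
  simp only [add_mul, mul_add, smul_mul_assoc, mul_smul_comm, hP, h1, h2, h3, smul_zero, add_zero,
    zero_add, inv_smul_smul₀ hμ]
  abel

theorem simple_inv_mul_simple {P : 𝔸} (hP : P * P = P) {μ : ℂ} (hμ : μ ≠ 0) :
    (P + μ⁻¹ • (1 - P)) * (P + μ • (1 - P)) = 1 := by
  simpa using simple_mul_simple_inv hP (inv_ne_zero hμ)

theorem projProd_mul_projProdRev (hid : ∀ j p, π j p * π j p = π j p) (l : ℕ) {μ : ℂ}
    (hμ : μ ≠ 0) (p : ℝ × ℝ) : projProd π l μ p * projProdRev π l μ⁻¹ p = 1 := by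
  induction l with
  | zero => simp [projProd, projProdRev]
  | succ l ih =>
    simp only [projProd, projProdRev]
    rw [mul_assoc, ← mul_assoc (projProd π l μ p), ih, one_mul, simple_mul_simple_inv (hid _ _) hμ]

theorem projProdRev_mul_projProd (hid : ∀ j p, π j p * π j p = π j p) (l : ℕ) {μ : ℂ}
    (hμ : μ ≠ 0) (p : ℝ × ℝ) : projProdRev π l μ⁻¹ p * projProd π l μ p = 1 := by
  induction l with
  | zero => simp [projProd, projProdRev]
  | succ l ih =>
    simp only [projProd, projProdRev]
    rw [mul_assoc, ← mul_assoc _ _ (projProd π l μ p), simple_inv_mul_simple (hid _ _) hμ, one_mul,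
      ih]

theorem projProd_zero_succ (l : ℕ) (p : ℝ × ℝ) :
    projProd π (l + 1) 0 p = π (l + 1) p * projProd π l 0 p := by
  simp [projProd]

theorem star_projProd [StarRing 𝔸] [StarModule ℂ 𝔸] (hsa : ∀ j p, star (π j p) = π j p) (l : ℕ)
    (μ : ℂ) (p : ℝ × ℝ) : star (projProd π l μ p) = projProdRev π l (conj μ) p := by
  induction l with
  | zero => simp [projProd, projProdRev]
  | succ l ih => simp [projProd, projProdRev, ih, hsa]

theorem continuous_projProd (l : ℕ) (p : ℝ × ℝ) : Continuous fun μ => projProd π l μ p := by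
  induction l with
  | zero => exact continuous_const
  | succ l ih => simp only [projProd]; fun_prop

theorem continuous_projProdRev (l : ℕ) (p : ℝ × ℝ) :
    Continuous fun μ => projProdRev π l μ p := by
  induction l with
  | zero => exact continuous_const
  | succ l ih => simp only [projProdRev]; fun_prop

theorem differentiable_simple (hπ : ∀ j, ContDiff ℝ ∞ (π j)) (l : ℕ) (μ : ℂ) :
    Differentiable ℝ fun p => π l p + μ • (1 - π l p) := by
  have := (hπ l).differentiable (by simp)
  fun_prop

theorem wirt_projProd_succ (hπ : ∀ j, ContDiff ℝ ∞ (π j)) (w : ℂ) (l : ℕ) (μ : ℂ) (p : ℝ × ℝ) :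
    wirt w (projProd π (l + 1) μ) p = (1 - μ) • wirt w (π (l + 1)) p * projProd π l μ p +
      (π (l + 1) p + μ • (1 - π (l + 1) p)) * wirt w (projProd π l μ) p := by
  rw [← wirt_simple w μ ((hπ (l + 1)).differentiable (by simp) p)]
  exact wirt_mul w (differentiable_simple hπ _ μ p)
    ((contDiff_projProd hπ l μ).differentiable (by simp) p)

theorem wirt_projProdRev_succ (hπ : ∀ j, ContDiff ℝ ∞ (π j)) (w : ℂ) (l : ℕ) (μ : ℂ)
    (p : ℝ × ℝ) :
    wirt w (projProdRev π (l + 1) μ) p =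
      wirt w (projProdRev π l μ) p * (π (l + 1) p + μ • (1 - π (l + 1) p)) +
      projProdRev π l μ p * (1 - μ) • wirt w (π (l + 1)) p := by
  rw [← wirt_simple w μ ((hπ (l + 1)).differentiable (by simp) p)]
  exact wirt_mul w ((contDiff_projProdRev hπ l μ).differentiable (by simp) p)
    (differentiable_simple hπ _ μ p)

theorem continuous_wirt_projProd (hπ : ∀ j, ContDiff ℝ ∞ (π j)) (w : ℂ) (l : ℕ) (p : ℝ × ℝ) :
    Continuous fun μ => wirt w (projProd π l μ) p := by
  induction l with
  | zero => exact (continuous_const : Continuous fun _ : ℂ => wirt w (fun _ => (1 : 𝔸)) p)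
  | succ l ih =>
    simp only [wirt_projProd_succ hπ]
    have := continuous_projProd (π := π) l p
    fun_prop

theorem continuous_wirt_projProdRev (hπ : ∀ j, ContDiff ℝ ∞ (π j)) (w : ℂ) (l : ℕ)
    (p : ℝ × ℝ) : Continuous fun μ => wirt w (projProdRev π l μ) p := by
  induction l with
  | zero => exact (continuous_const : Continuous fun _ : ℂ => wirt w (fun _ => (1 : 𝔸)) p)
  | succ l ih =>
    simp only [wirt_projProdRev_succ hπ]
    have := continuous_projProdRev (π := π) l p
    fun_prop

/-- Extends identities by continuity to the parameters where their derivation breaks down, above all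
to `μ = 0`, where the products are no longer invertible. -/
theorem eq_of_forall_ne_ne {X : Type*} [TopologicalSpace X] [T2Space X] {f g : ℂ → X}
    (hf : Continuous f) (hg : Continuous g) (a b : ℂ)
    (h : ∀ μ, μ ≠ a → μ ≠ b → f μ = g μ) (μ : ℂ) : f μ = g μ := by
  have hd : Dense ({a, b}ᶜ : Set ℂ) := (Set.toFinite {a, b}).countable.dense_compl ℝ
  refine congr_fun (hf.ext_on hd hg fun ν hν => ?_) μ
  simp only [Set.mem_compl_iff, Set.mem_insert_iff, Set.mem_singleton_iff, not_or] at hν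
  exact h ν hν.1 hν.2

end Products

/-! ### The linear equation in `μ` and the removal of the last factor. -/

section LaxEquation

variable {𝔸 : Type*} [NormedRing 𝔸] [NormedAlgebra ℂ 𝔸] {π : ℕ → ℝ × ℝ → 𝔸}

/-- The equation `2 ∂_z φ = (μ - 1) P φ` for `φ = (π_l + μ π_l^⊥) ⋯ (π_1 + μ π_1^⊥)`. -/
def IsLax (π : ℕ → ℝ × ℝ → 𝔸) (l : ℕ) (P : ℝ × ℝ → 𝔸) : Prop :=
  ∀ μ p, wirt (-Complex.I) (projProd π l μ) p = (μ - 1) • (P p * projProd π l μ p)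

/-- The inverse of a solution of the equation satisfies `ν 2 ∂_z Ψ = (ν - 1) Ψ P`. -/
theorem IsLax.rev (hπ : ∀ j, ContDiff ℝ ∞ (π j)) (hid : ∀ j p, π j p * π j p = π j p) {l : ℕ}
    {P : ℝ × ℝ → 𝔸} (h : IsLax π l P) (ν : ℂ) (p : ℝ × ℝ) :
    ν • wirt (-Complex.I) (projProdRev π l ν) p = (ν - 1) • (projProdRev π l ν p * P p) := by
  have c1 := continuous_wirt_projProdRev hπ (-Complex.I) l p
  have c2 := continuous_projProdRev (π := π) l p
  refine eq_of_forall_ne_ne (f := fun ν => ν • wirt (-Complex.I) (projProdRev π l ν) p)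
    (g := fun ν => (ν - 1) • (projProdRev π l ν p * P p)) (by fun_prop) (by fun_prop) 0 0
    (fun ν hν _ => ?_) ν
  have hone : (fun q => projProdRev π l ν q * projProd π l ν⁻¹ q) = fun _ => 1 := by
    funext q
    simpa using projProdRev_mul_projProd hid l (inv_ne_zero hν) q
  have hd := wirt_mul (-Complex.I) ((contDiff_projProdRev hπ l ν).differentiable (by simp) p)
    ((contDiff_projProd hπ l ν⁻¹).differentiable (by simp) p)
  rw [hone, wirt_const, h ν⁻¹ p] at hd
  have hinv : projProd π l ν⁻¹ p * projProdRev π l ν p = 1 := by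
    simpa using projProd_mul_projProdRev hid l (inv_ne_zero hν) p
  have key := congr_arg (fun x => ν • (x * projProdRev π l ν p)) hd
  simp only [zero_mul, smul_zero, add_mul, mul_assoc, hinv, mul_one, mul_smul_comm,
    smul_mul_assoc, smul_add, smul_smul, mul_sub, mul_inv_cancel₀ hν] at key
  rw [eq_neg_of_add_eq_zero_left key.symm, ← neg_smul, neg_sub]

theorem IsLax.projProdRev_mul (hπ : ∀ j, ContDiff ℝ ∞ (π j))
    (hid : ∀ j p, π j p * π j p = π j p) {l : ℕ} {P : ℝ × ℝ → 𝔸} (h : IsLax π l P)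
    (p : ℝ × ℝ) : projProdRev π l 0 p * P p = 0 := by
  simpa using (h.rev hπ hid 0 p).symm

/-- For `ν ≠ 0` the equation of the inverse can be divided by `ν`; the result then passes to the
limit `ν → 0`. -/
theorem IsLax.wirt_projProdRev_mul (hπ : ∀ j, ContDiff ℝ ∞ (π j))
    (hid : ∀ j p, π j p * π j p = π j p) {l : ℕ} {P : ℝ × ℝ → 𝔸} (h : IsLax π l P)
    {p : ℝ × ℝ} {X : 𝔸} (hX : P p * X = 0) :
    wirt (-Complex.I) (projProdRev π l 0) p * X = 0 := by
  have c1 := continuous_wirt_projProdRev hπ (-Complex.I) l p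
  refine eq_of_forall_ne_ne (f := fun ν => wirt (-Complex.I) (projProdRev π l ν) p * X)
    (g := fun _ => 0) (by fun_prop) (by fun_prop) 0 0 (fun ν hν _ => ?_) 0
  have e := congr_arg (fun x => x * X) (h.rev hπ hid ν p)
  simp only [smul_mul_assoc, mul_assoc, hX, mul_zero, smul_zero] at e
  exact (smul_eq_zero_iff_right hν).1 e

/-- Solving for the coefficient at one invertible parameter (`μ = -1`, that is `λ = 0`) shows that
it is continuous, although `IsLax` does not require this. -/
theorem IsLax.eq_smul (hid : ∀ j p, π j p * π j p = π j p) {l : ℕ} {P : ℝ × ℝ → 𝔸}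
    (h : IsLax π l P) :
    P = fun p => (-2 : ℂ)⁻¹ • (wirt (-Complex.I) (projProd π l (-1)) p *
      projProdRev π l (-1)⁻¹ p) := by
  funext p
  rw [h (-1) p, smul_mul_assoc, mul_assoc, projProd_mul_projProdRev hid l (by norm_num), mul_one,
    smul_smul]
  norm_num

theorem IsLax.continuous (hπ : ∀ j, ContDiff ℝ ∞ (π j)) (hid : ∀ j p, π j p * π j p = π j p)
    {l : ℕ} {P : ℝ × ℝ → 𝔸} (h : IsLax π l P) : Continuous P := by
  rw [h.eq_smul hid]
  exact ((continuous_wirt _ (contDiff_projProd hπ l (-1))).mul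
    (contDiff_projProdRev hπ l _).continuous).const_smul _

theorem IsLax.zero {P : ℝ × ℝ → 𝔸} (h : IsLax π 0 P) (p : ℝ × ℝ) : P p = 0 := by
  have := h 0 p
  have e : projProd π 0 0 = fun _ => 1 := rfl
  rw [e, wirt_const] at this
  simpa using this

/-- At the points of a dense set, the image of `π_l` is that of `π_l ⋯ π_1`. -/
def DenseFactor (π : ℕ → ℝ × ℝ → 𝔸) (l : ℕ) : Prop :=
  Dense {p | (∃ Y, projProd π l 0 p * Y = π l p) ∧ ∃ Y, Y * projProdRev π l 0 p = π l p}

/-- The value `ν = 0` gives `π_1 ⋯ π_l P = 0`; on a dense set `π_l` is a left multiple of that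
product, and continuity does the rest. -/
theorem IsLax.mul_eq_zero (hπ : ∀ j, ContDiff ℝ ∞ (π j)) (hid : ∀ j p, π j p * π j p = π j p)
    {l : ℕ} (hD : DenseFactor π l) {P : ℝ × ℝ → 𝔸} (h : IsLax π l P) (p : ℝ × ℝ) :
    π l p * P p = 0 := by
  refine congr_fun (Continuous.ext_on (f := fun p => π l p * P p) (g := fun _ => 0) hD
    ((hπ l).continuous.mul (h.continuous hπ hid)) continuous_const ?_) p
  rintro q ⟨-, Y, hY⟩
  simp only [← hY]
  rw [mul_assoc, h.projProdRev_mul hπ hid, mul_zero]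

/-- Differentiate `T = π_{l+1} T` for the product `T` at `μ = 0`. As `2∂_z T = -P T` and `π_{l+1} P
= 0`, the claim holds after multiplication by `T`; density replaces `T` by `π_{l+1}`. -/
theorem IsLax.wirt_mul_eq (hπ : ∀ j, ContDiff ℝ ∞ (π j)) (hid : ∀ j p, π j p * π j p = π j p)
    {l : ℕ} (hD : DenseFactor π (l + 1)) {P : ℝ × ℝ → 𝔸} (h : IsLax π (l + 1) P) (p : ℝ × ℝ) :
    (wirt (-Complex.I) (π (l + 1)) p + P p) * π (l + 1) p = 0 := by
  have cw := continuous_wirt (-Complex.I) (hπ (l + 1))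
  refine congr_fun (Continuous.ext_on
    (f := fun p => (wirt (-Complex.I) (π (l + 1)) p + P p) * π (l + 1) p) (g := fun _ => 0) hD
    ((cw.add (h.continuous hπ hid)).mul (hπ _).continuous) continuous_const ?_) p
  rintro q ⟨⟨Y, hY⟩, -⟩
  have e : (fun r => π (l + 1) r * projProd π (l + 1) 0 r) = projProd π (l + 1) 0 := by
    funext r
    rw [projProd_zero_succ, ← mul_assoc, hid]
  have d := wirt_mul (-Complex.I) ((hπ (l + 1)).differentiable (by simp) q)
    ((contDiff_projProd hπ (l + 1) 0).differentiable (by simp) q)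
  rw [e, h 0 q] at d
  simp only [zero_sub, neg_smul, one_smul, mul_neg, ← mul_assoc, h.mul_eq_zero hπ hid hD, zero_mul,
    neg_zero, add_zero] at d
  simp only
  conv_lhs => rw [← hY, ← mul_assoc, add_mul, ← d, neg_add_cancel, zero_mul]

theorem IsLax.pred (hπ : ∀ j, ContDiff ℝ ∞ (π j)) (hid : ∀ j p, π j p * π j p = π j p)
    {l : ℕ} (hD : DenseFactor π (l + 1)) {P : ℝ × ℝ → 𝔸} (h : IsLax π (l + 1) P) :
    IsLax π l (fun p => (wirt (-Complex.I) (π (l + 1)) p + P p) * (1 - π (l + 1) p)) := by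
  intro μ p
  have c1 := continuous_wirt_projProd hπ (-Complex.I) l p
  have c2 := continuous_projProd (π := π) l p
  refine eq_of_forall_ne_ne (f := fun μ => wirt (-Complex.I) (projProd π l μ) p)
    (g := fun μ => (μ - 1) • ((wirt (-Complex.I) (π (l + 1)) p + P p) * (1 - π (l + 1) p) *
      projProd π l μ p)) (by fun_prop) (by fun_prop) 0 0 (fun μ hμ _ => ?_) μ
  have e := h μ p
  have e1 := h.mul_eq_zero hπ hid hD p
  have e2 := h.wirt_mul_eq hπ hid hD p
  rw [wirt_projProd_succ hπ, ← eq_sub_iff_add_eq'] at e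
  have hinv := simple_inv_mul_simple (hid (l + 1) p) hμ
  simp only [projProd] at e
  have hdiff := wirt_mul (-Complex.I) ((hπ (l + 1)).differentiable (by simp) p)
    ((hπ (l + 1)).differentiable (by simp) p)
  simp only [hid] at hdiff
  change wirt (-Complex.I) (π (l + 1)) p = _ at hdiff
  generalize wirt (-Complex.I) (π (l + 1)) p = D at *
  generalize wirt (-Complex.I) (projProd π l μ) p = E at *
  generalize projProd π l μ p = F at *
  have hQ := hid (l + 1) p
  generalize π (l + 1) p = Q at *
  generalize P p = A at *
  have key : E = (Q + μ⁻¹ • (1 - Q)) * ((μ - 1) • (A * ((Q + μ • (1 - Q)) * F)) -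
      (1 - μ) • D * F) := by
    rw [← e, ← mul_assoc, hinv, one_mul]
  have e3 : A * Q = -(D * Q) := eq_neg_of_add_eq_zero_right (by rwa [add_mul] at e2)
  -- The new coefficient is the gauge transform of the old one. Its `μ`-dependence cancels because
  -- `Q A = 0` and `(D + A) Q = 0`.
  have e4 : (Q + μ⁻¹ • (1 - Q)) * (A * (Q + μ • (1 - Q)) + D) = (D + A) * (1 - Q) := by
    have e5 : D * (1 - Q) = Q * D := by
      rw [mul_sub, mul_one]; exact sub_eq_of_eq_add' hdiff
    have e6 : A * (Q + μ • (1 - Q)) + D = Q * D + μ • (A * (1 - Q)) := by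
      rw [mul_add, e3, ← e5, mul_sub D, mul_one, mul_smul_comm]; abel
    have e7 : (1 - Q) * (Q * D) = 0 := by rw [← mul_assoc, sub_mul, hQ, one_mul, sub_self, zero_mul]
    have e8 : (1 - Q) * (A * (1 - Q)) = A * (1 - Q) := by
      rw [← mul_assoc, sub_mul, e1, one_mul, sub_zero]
    rw [e6, add_mul (D : 𝔸), e5, mul_add, add_mul, add_mul, ← mul_assoc Q Q, hQ, mul_smul_comm,
      ← mul_assoc Q A, e1, smul_mul_assoc, smul_mul_assoc, e7, mul_smul_comm, e8, zero_mul,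
      inv_smul_smul₀ hμ, smul_zero, smul_zero, add_zero, zero_add]
  rw [key, ← e4]
  simp only [← neg_sub μ 1, neg_smul, neg_mul, sub_neg_eq_add, smul_mul_assoc, ← smul_add,
    mul_smul_comm, add_mul, mul_add, mul_assoc]

end LaxEquation

/-! ### Equal ranks make the kernel of `π_l ⋯ π_1` locally constant. -/

section ConstantKernel

variable {𝔸 : Type*} [NormedRing 𝔸] [NormedAlgebra ℂ 𝔸]

/-- If all the derivatives of `T` are left multiples of `T`, then the right annihilator of `T` is
locally constant. -/
theorem eventually_mul_eq_zero_of_wirt {T A B : ℝ × ℝ → 𝔸} (hT : ContDiff ℝ ∞ T) {p₀ : ℝ × ℝ}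
    (hA : ContinuousAt A p₀) (hB : ContinuousAt B p₀)
    (h : ∀ᶠ q in nhds p₀, wirt Complex.I T q = A q * T q ∧ wirt (-Complex.I) T q = B q * T q) :
    ∀ᶠ p in nhds p₀, ∀ X, T p * X = 0 → T p₀ * X = 0 := by
  have hA' := hA.norm.eventually (gt_mem_nhds (lt_add_one ‖A p₀‖))
  have hB' := hB.norm.eventually (gt_mem_nhds (lt_add_one ‖B p₀‖))
  obtain ⟨ε, hε, hball⟩ := Metric.eventually_nhds_iff_ball.1 (h.and (hA'.and hB'))
  refine Metric.eventually_nhds_iff_ball.2 ⟨ε, hε, fun p hp X hX => ?_⟩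
  set v : ℝ × ℝ := p₀ - p with hv
  set γ : ℝ → ℝ × ℝ := fun s => p + s • v with hγ
  have hγd : ∀ s, HasDerivAt γ v s := fun s => by
    simpa only [one_smul, hγ, id] using ((hasDerivAt_id s).smul_const v).const_add p
  have hγb : ∀ s ∈ Set.Icc (0 : ℝ) 1, γ s ∈ Metric.ball p₀ ε := fun s hs =>
    (convex_ball p₀ ε).add_smul_sub_mem hp (Metric.mem_ball_self hε) hs
  set α : ℂ := (v.1 / 2 - v.2 * Complex.I / 2 : ℂ)
  set β : ℂ := (v.1 / 2 + v.2 * Complex.I / 2 : ℂ)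
  have hf : ∀ s, HasDerivAt (fun s => T (γ s) * X) (fderiv ℝ T (γ s) v * X) s := fun s =>
    (((hT.differentiable (by simp) (γ s)).hasFDerivAt.comp_hasDerivAt s (hγd s)).mul_const X)
  -- Grönwall along the segment from `p` to `p₀`, with `A` and `B` bounded on the ball by continuity
  -- at `p₀`.
  have := eq_zero_of_abs_deriv_le_mul_abs_self_of_eq_zero_right
    (f := fun s => T (γ s) * X) (f' := fun s => fderiv ℝ T (γ s) v * X)
    (K := ‖α‖ * (‖A p₀‖ + 1) + ‖β‖ * (‖B p₀‖ + 1)) (a := 0) (b := 1)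
    (fun s _ => (hf s).continuousAt.continuousWithinAt) (fun s _ => (hf s).hasDerivWithinAt)
    (by simpa [hγ] using hX) (fun s hs => ?_) 1 (by simp)
  · simpa [hγ, hv] using this
  · obtain ⟨⟨h1, h2⟩, h3, h4⟩ := hball _ (hγb s ⟨hs.1, hs.2.le⟩)
    rw [fderiv_eq_wirt, h1, h2, ← smul_mul_assoc, ← smul_mul_assoc, ← add_mul, mul_assoc]
    refine (norm_mul_le _ _).trans (mul_le_mul_of_nonneg_right ?_ (norm_nonneg _))
    refine (norm_add_le _ _).trans ?_
    rw [norm_smul, norm_smul]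
    gcongr

variable {π : ℕ → ℝ × ℝ → 𝔸}

theorem IsLax.exists_of_le (hπ : ∀ j, ContDiff ℝ ∞ (π j)) (hid : ∀ j p, π j p * π j p = π j p)
    {k : ℕ} (hD : ∀ l ∈ Set.Icc 1 k, DenseFactor π l) {P : ℝ × ℝ → 𝔸} (h : IsLax π k P) {l : ℕ}
    (hl : l ≤ k) : ∃ P', IsLax π l P' := by
  induction hl using Nat.decreasingInduction with
  | self => exact ⟨P, h⟩
  | of_succ l hl ih =>
    obtain ⟨P', h'⟩ := ih
    exact ⟨_, h'.pred hπ hid (hD _ ⟨by omega, hl⟩)⟩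

variable [StarRing 𝔸] [StarModule ℂ 𝔸] [ContinuousStar 𝔸]

/-- Stripping the only factor leaves the empty product, whose coefficient vanishes. Hence `2∂_z π_1
= -P`, so `π_1 ∂_z π_1 = 0`; the adjoint of this says that `Im π_1` is holomorphic. -/
theorem IsLax.wirt_one_mul (hπ : ∀ j, ContDiff ℝ ∞ (π j)) (hid : ∀ j p, π j p * π j p = π j p)
    (hsa : ∀ j p, star (π j p) = π j p) (hD : DenseFactor π 1) {P : ℝ × ℝ → 𝔸}
    (h : IsLax π 1 P) (p : ℝ × ℝ) : wirt Complex.I (π 1) p * π 1 p = 0 := by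
  have e0 := (h.pred hπ hid hD).zero p
  have e1 := h.wirt_mul_eq hπ hid hD p
  have e2 : wirt (-Complex.I) (π 1) p = -P p := by
    rw [zero_add] at e0 e1
    rw [mul_sub, mul_one, e1, sub_zero] at e0
    exact eq_neg_of_add_eq_zero_left e0
  have e3 : π 1 p * wirt (-Complex.I) (π 1) p = 0 := by
    rw [e2, mul_neg, h.mul_eq_zero hπ hid hD, neg_zero]
  have e4 : wirt (-Complex.I) (π 1) p = star (wirt Complex.I (π 1) p) := by
    have := wirt_star (F := π 1) (p := p) (-Complex.I)
    simpa [hsa] using this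
  have e5 := congr_arg star e3
  simpa [e4, hsa] using e5

variable [CompleteSpace 𝔸]

/-- The derivative `2 ∂_{z̄}` of `T = π_l ⋯ π_1` is a left multiple of `T` where the images of `π_l`
and `π_{l+1}` are close to each other. -/
theorem exists_wirt_projProd_eq (hπ : ∀ j, ContDiff ℝ ∞ (π j))
    (hid : ∀ j p, π j p * π j p = π j p) (hsa : ∀ j p, star (π j p) = π j p) {l : ℕ}
    (hl : 1 ≤ l) {P : ℝ × ℝ → 𝔸} (h : IsLax π l P) (hP : ∀ p, P p * π (l + 1) p = 0)
    {p₀ : ℝ × ℝ}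
    (hG : IsUnit (π (l + 1) p₀ * π l p₀ + (1 - π (l + 1) p₀) * (1 - π l p₀))) :
    ∃ A : ℝ × ℝ → 𝔸, ContinuousAt A p₀ ∧
      ∀ᶠ q in nhds p₀, wirt Complex.I (projProd π l 0) q = A q * projProd π l 0 q := by
  set Q := π (l + 1) with hQ
  set G : ℝ × ℝ → 𝔸 := fun p => Q p * π l p + (1 - Q p) * (1 - π l p) with hGdef
  have hGc : Continuous G := by
    have h1 := (hπ l).continuous
    have h2 := (hπ (l + 1)).continuous
    fun_prop
  have hDc := continuous_wirt Complex.I (hπ l)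
  refine ⟨fun p => Ring.inverse (G p) * ((1 - Q p) * (1 - π l p) * wirt Complex.I (π l) p -
    Q p * wirt Complex.I (π l) p), ?_, ?_⟩
  · refine ContinuousAt.mul ?_ ?_
    · exact (differentiableAt_inverse (𝕜 := ℝ) (x := G p₀) hG).continuousAt.comp hGc.continuousAt
    · have h1 := (hπ l).continuous
      have h2 := (hπ (l + 1)).continuous
      have : Continuous fun p => ((1 - Q p) * (1 - π l p) * wirt Complex.I (π l) p -
        Q p * wirt Complex.I (π l) p) := by fun_prop
      exact this.continuousAt
  · filter_upwards [hGc.continuousAt.eventually (Units.isOpen.mem_nhds hG)] with q hq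
    -- Adjoint of `∂_z (π_1 ⋯ π_l) π_{l+1} = 0`, which holds because `P π_{l+1} = 0`.
    have hQT : Q q * wirt Complex.I (projProd π l 0) q = 0 := by
      have e := h.wirt_projProdRev_mul hπ hid (hP q)
      have e' : projProdRev π l 0 = fun p => star (projProd π l 0 p) := by
        funext p; rw [star_projProd hsa, map_zero]
      rw [e', wirt_star] at e
      have e2 := congr_arg star e
      simpa [hsa, hQ] using e2
    obtain ⟨m, rfl⟩ : ∃ m, l = m + 1 := ⟨l - 1, by omega⟩
    have hT : (fun r => π (m + 1) r * projProd π (m + 1) 0 r) = projProd π (m + 1) 0 := by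
      funext r
      rw [projProd_zero_succ, ← mul_assoc, hid]
    have d := wirt_mul Complex.I ((hπ (m + 1)).differentiable (by simp) q)
      ((contDiff_projProd hπ (m + 1) 0).differentiable (by simp) q)
    rw [hT] at d
    -- Write `T = π_l ⋯ π_1`. From `T = π_l T`, both `π_l^⊥ ∂_z̄ T` and `∂_z̄ T - π_l ∂_z̄ T` are
    -- left multiples of `T`; `hQT` removes the remaining unknown term.
    have key : G q * wirt Complex.I (projProd π (m + 1) 0) q =
        ((1 - Q q) * (1 - π (m + 1) q) * wirt Complex.I (π (m + 1)) q -
          Q q * wirt Complex.I (π (m + 1)) q) * projProd π (m + 1) 0 q := by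
      generalize wirt Complex.I (projProd π (m + 1) 0) q = E at *
      generalize wirt Complex.I (π (m + 1)) q = D at *
      generalize projProd π (m + 1) 0 q = F at *
      have d1 : π (m + 1) q * E = E - D * F := eq_sub_of_add_eq' d.symm
      have d2 : (1 - π (m + 1) q) * E = (1 - π (m + 1) q) * (D * F) := by
        have hi := hid (m + 1) q
        generalize π (m + 1) q = Z at *
        have : (1 - Z) * Z = 0 := by rw [sub_mul, one_mul, hi, sub_self]
        conv_lhs => rw [d, mul_add, ← mul_assoc (1 - Z) Z, this, zero_mul, add_zero]
      simp only [hGdef, add_mul _ _ E, sub_mul _ _ F, mul_assoc]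
      rw [d2, d1, mul_sub, hQT]
      abel
    rw [mul_assoc, ← key, ← mul_assoc, Ring.inverse_mul_cancel _ hq, one_mul]

/-- If `π_{l+1}` is as large as `π_l` somewhere, then `π_1` contains constant vectors: the columns of
`(π_l ⋯ π_1)^*` at that point. -/
theorem mul_projProdRev_eq (hπ : ∀ j, ContDiff ℝ ∞ (π j))
    (hid : ∀ j p, π j p * π j p = π j p) (hsa : ∀ j p, star (π j p) = π j p) {l : ℕ}
    (hl : 1 ≤ l) {P : ℝ × ℝ → 𝔸} (h : IsLax π l P) (hP : ∀ p, P p * π (l + 1) p = 0)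
    (hhol : ∀ p, wirt Complex.I (π 1) p * π 1 p = 0) (hPc : Continuous P) {p₀ : ℝ × ℝ}
    (hG : IsUnit (π (l + 1) p₀ * π l p₀ + (1 - π (l + 1) p₀) * (1 - π l p₀))) (p : ℝ × ℝ) :
    π 1 p * projProdRev π l 0 p₀ = projProdRev π l 0 p₀ := by
  refine mul_eq_self_of_eventually (hπ 1) (hid 1) hhol (p₀ := p₀) ?_ p
  obtain ⟨A, hA, hAe⟩ := exists_wirt_projProd_eq hπ hid hsa hl h hP hG
  have hB : ∀ q, wirt (-Complex.I) (projProd π l 0) q = -P q * projProd π l 0 q := fun q => by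
    rw [h 0 q]; simp
  filter_upwards [eventually_mul_eq_zero_of_wirt (contDiff_projProd hπ l 0) hA
    hPc.neg.continuousAt (hAe.mono fun q hq => ⟨hq, hB q⟩)] with q hq
  -- The rightmost factor of the product is `π_1`, so `ker π_1(q)` lies in its kernel at `q`, hence
  -- in its kernel at `p₀`.
  have h1 : ∀ m, projProd π (m + 1) 0 q * (1 - π 1 q) = 0 := fun m => by
    induction m with
    | zero => simp [projProd, mul_sub, hid]
    | succ m ih => rw [projProd_zero_succ, mul_assoc, ih, mul_zero]
  have h2 := hq (1 - π 1 q) (by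
    obtain ⟨m, rfl⟩ : ∃ m, l = m + 1 := ⟨l - 1, by omega⟩
    exact h1 m)
  have h3 := congr_arg star h2
  rw [star_mul, star_projProd hsa, map_zero, star_sub, star_one, hsa, star_zero, sub_mul, one_mul,
    sub_eq_zero] at h3
  exact h3.symm

/-- The conclusion for a solution of the equation with spectral parameter. -/
theorem IsLax.mul_projProdRev_eq (hπ : ∀ j, ContDiff ℝ ∞ (π j))
    (hid : ∀ j p, π j p * π j p = π j p) (hsa : ∀ j p, star (π j p) = π j p) {k : ℕ}
    (hD : ∀ l ∈ Set.Icc 1 k, DenseFactor π l) {P : ℝ × ℝ → 𝔸} (h : IsLax π k P) {l : ℕ}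
    (hl : 1 ≤ l) (hlk : l + 1 ≤ k) {p₀ : ℝ × ℝ}
    (hG : IsUnit (π (l + 1) p₀ * π l p₀ + (1 - π (l + 1) p₀) * (1 - π l p₀))) (p : ℝ × ℝ) :
    π 1 p * projProdRev π l 0 p₀ = projProdRev π l 0 p₀ := by
  obtain ⟨P₁, h₁⟩ := h.exists_of_le hπ hid hD (l := 1) (by omega)
  obtain ⟨P', h'⟩ := h.exists_of_le hπ hid hD hlk
  have hl' := h'.pred hπ hid (hD _ ⟨by omega, hlk⟩)
  refine Ward.mul_projProdRev_eq hπ hid hsa hl hl' (fun q => ?_)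
    (h₁.wirt_one_mul hπ hid hsa (hD 1 ⟨le_rfl, by omega⟩)) (hl'.continuous hπ hid) hG p
  rw [mul_assoc, sub_mul, one_mul, hid, sub_self, mul_zero]

end ConstantKernel

/-! ### Pairs of Hermitian projections and their ranks. -/

section Projections

variable {n : ℕ} {P Q : Mat n}

theorem mem_im_iff (hP : P * P = P) {v : Fin n → ℂ} : v ∈ im P ↔ P.mulVec v = v := by
  constructor
  · rintro ⟨w, rfl⟩
    simp [Matrix.mulVec_mulVec, hP]
  · intro h
    exact ⟨v, h⟩

theorem isUnit_of_mulVec {M : Mat n} (h : ∀ v, M.mulVec v = 0 → v = 0) : IsUnit M := by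
  rw [← Matrix.mulVec_injective_iff_isUnit]
  intro v w hvw
  exact sub_eq_zero.1 (h _ (by rw [Matrix.mulVec_sub]; exact sub_eq_zero.2 hvw))

theorem eq_zero_of_mem_im_of_mulVec (hP : P * P = P)
    (h : im P ⊓ im (1 - Q) = ⊥) {v : Fin n → ℂ} (hv : P.mulVec v = v) (hQv : Q.mulVec v = 0) :
    v = 0 := by
  have : v ∈ im P ⊓ im (1 - Q) := ⟨(mem_im_iff hP).2 hv, v, by simp [hQv]⟩
  rwa [h, Submodule.mem_bot] at this

open scoped ComplexOrder in
-- `PQP + P^⊥` is invertible: a vector `v` in its kernel lies in `Im P` and satisfies `PQPv = 0`,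
-- that is `(QP)^*(QP)v = 0`, so `Qv = 0`.
theorem exists_mul_mul_eq (hP : IsHermitianProjection P) (hQ : IsHermitianProjection Q)
    (h : im P ⊓ im (1 - Q) = ⊥) : ∃ Y, P * Q * Y = P := by
  set M : Mat n := P * Q * P + (1 - P) with hM
  have hPM : P * M = P * Q * P := by
    simp only [hM, mul_add, mul_sub, ← mul_assoc, hP.2, mul_one, sub_self, add_zero]
  have hU : IsUnit M := isUnit_of_mulVec fun v hv => by
    have h1 : (P * Q * P).mulVec v = 0 := by
      rw [← hPM, ← Matrix.mulVec_mulVec, hv, Matrix.mulVec_zero]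
    have h2 : P.mulVec v = v := by
      rw [hM, Matrix.add_mulVec, h1, zero_add, Matrix.sub_mulVec, Matrix.one_mulVec,
        sub_eq_zero] at hv
      exact hv.symm
    refine eq_zero_of_mem_im_of_mulVec hP.2 h h2 ?_
    have h3 : ((Q * P).conjTranspose * (Q * P)).mulVec v = 0 := by
      rw [Matrix.conjTranspose_mul, hP.1.eq, hQ.1.eq, mul_assoc, ← mul_assoc Q, hQ.2, ← mul_assoc,
        h1]
    rw [Matrix.conjTranspose_mul_self_mulVec_eq_zero, ← Matrix.mulVec_mulVec, h2] at h3
    exact h3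
  obtain ⟨u, hu⟩ := hU
  refine ⟨P * (↑u⁻¹ : Mat n), ?_⟩
  rw [← mul_assoc, ← hPM, ← hu, mul_assoc, Units.mul_inv, mul_one]

theorem rank_le_of_inf_eq_bot (hP : IsHermitianProjection P) (hQ : IsHermitianProjection Q)
    (h : im P ⊓ im (1 - Q) = ⊥) : P.rank ≤ Q.rank := by
  obtain ⟨Y, hY⟩ := exists_mul_mul_eq hP hQ h
  calc P.rank = (P * Q * Y).rank := by rw [hY]
    _ ≤ (P * Q).rank := Matrix.rank_mul_le_left _ _
    _ ≤ Q.rank := Matrix.rank_mul_le_right _ _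

/-- Equal ranks give `ker PQ = ker Q`. A vector killed by the sum is killed by `PQ`, hence by `Q`,
and then also by `P^⊥`, so it lies in `Im P ∩ Im Q^⊥`. -/
theorem isUnit_of_rank_eq (hP : IsHermitianProjection P) (hQ : IsHermitianProjection Q)
    (h : im P ⊓ im (1 - Q) = ⊥) (hr : P.rank = Q.rank) :
    IsUnit (P * Q + (1 - P) * (1 - Q)) := by
  obtain ⟨Y, hY⟩ := exists_mul_mul_eq hP hQ h
  have hle : LinearMap.ker Q.mulVecLin ≤ LinearMap.ker (P * Q).mulVecLin := fun v hv => by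
    simp only [LinearMap.mem_ker, Matrix.mulVecLin_apply] at hv ⊢
    rw [← Matrix.mulVec_mulVec, hv, Matrix.mulVec_zero]
  have hrank : Q.rank ≤ (P * Q).rank := by
    rw [← hr]
    conv_lhs => rw [← hY]
    exact Matrix.rank_mul_le_left _ _
  have hker : LinearMap.ker Q.mulVecLin = LinearMap.ker (P * Q).mulVecLin := by
    refine Submodule.eq_of_le_of_finrank_le hle ?_
    have h1 := Q.mulVecLin.finrank_range_add_finrank_ker
    have h2 := (P * Q).mulVecLin.finrank_range_add_finrank_ker
    rw [Matrix.rank, Matrix.rank] at hrank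
    omega
  refine isUnit_of_mulVec fun v hv => ?_
  have h1 : (P * Q).mulVec v = 0 := by
    have e : P * (P * Q + (1 - P) * (1 - Q)) = P * Q := by
      have z : P * (1 - P) = 0 := by rw [mul_sub, mul_one, hP.2, sub_self]
      rw [mul_add, ← mul_assoc, hP.2, ← mul_assoc, z, zero_mul, add_zero]
    rw [← e, ← Matrix.mulVec_mulVec, hv, Matrix.mulVec_zero]
  have h2 : Q.mulVec v = 0 := by
    have : v ∈ LinearMap.ker Q.mulVecLin := hker ▸ (by simpa using h1)
    simpa using this
  refine eq_zero_of_mem_im_of_mulVec hP.2 h ?_ h2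
  rw [Matrix.add_mulVec, h1, zero_add, ← Matrix.mulVec_mulVec, Matrix.sub_mulVec 1 Q, h2,
    Matrix.one_mulVec, sub_zero, Matrix.sub_mulVec, Matrix.one_mulVec, sub_eq_zero] at hv
  exact hv.symm

theorem trace_eq_rank (hP : P * P = P) : P.trace = P.rank := by
  have hproj : LinearMap.IsProj (LinearMap.range P.mulVecLin) P.mulVecLin :=
    ⟨fun v => ⟨v, rfl⟩, fun v hv => (mem_im_iff hP).1 hv⟩
  have := hproj.trace
  rw [Matrix.rank, ← this, ← Matrix.toLin'_apply', Matrix.trace_toLin'_eq]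

theorem rank_eq_of_continuous {X : Type*} [TopologicalSpace X] [PreconnectedSpace X]
    {F : X → Mat n} (hF : Continuous F) (hid : ∀ p, F p * F p = F p) (p q : X) :
    (F p).rank = (F q).rank := by
  have hc : Continuous fun p => ((F p).rank : ℝ) := by
    have : (fun p => ((F p).rank : ℝ)) = fun p => (F p).trace.re := by
      funext p; rw [trace_eq_rank (hid p), Complex.natCast_re]
    rw [this]
    exact Complex.continuous_re.comp hF.matrix_trace
  exact PreconnectedSpace.constant inferInstance
    ((Nat.isClosedEmbedding_coe_real.isEmbedding.continuous_iff).2 hc)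

end Projections

/-! ### Entrywise calculus compared with calculus in the normed algebra of matrices. -/

section MatrixCalculus

open scoped Matrix.Norms.L2Operator

variable {n : ℕ}

theorem contDiff_of_entries {E : Type*} [NormedAddCommGroup E] [NormedSpace ℝ E] {F : E → Mat n}
    (h : ∀ a b, ContDiff ℝ ∞ fun p => F p a b) : ContDiff ℝ ∞ F := by
  have : F = fun p => ∑ a, ∑ b, F p a b • Matrix.single a b (1 : ℂ) := by
    funext p
    conv_lhs => rw [Matrix.matrix_eq_sum_single (F p)]
    simp
  rw [this]
  exact ContDiff.sum fun a _ => ContDiff.sum fun b _ => (h a b).smul contDiff_const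

theorem dirDeriv_eq_fderiv {E : Type*} [NormedAddCommGroup E] [NormedSpace ℝ E] {F : E → Mat n}
    {p : E} (h : DifferentiableAt ℝ F p) (e : E) : dirDeriv e F p = fderiv ℝ F p e := by
  ext a b
  have := (((Matrix.entryLinearMap ℝ ℂ a b).toContinuousLinearMap.hasFDerivAt).comp p
    h.hasFDerivAt).fderiv
  exact congr_arg (fun T : E →L[ℝ] ℂ => T e) this

theorem dirDeriv_plane {F : ℝ × ℝ → Mat n} (h : Differentiable ℝ F) (e p : SpaceTime) :
    dirDeriv e (fun q : SpaceTime => F (q.1, q.2.1)) p =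
      fderiv ℝ F (p.1, p.2.1) (e.1, e.2.1) := by
  set L : SpaceTime →L[ℝ] ℝ × ℝ := (ContinuousLinearMap.fst ℝ ℝ (ℝ × ℝ)).prod
    ((ContinuousLinearMap.fst ℝ ℝ ℝ).comp (ContinuousLinearMap.snd ℝ ℝ (ℝ × ℝ)))
  have hc := (h (L p)).hasFDerivAt.comp p L.hasFDerivAt
  have := dirDeriv_eq_fderiv hc.differentiableAt e
  rw [hc.fderiv] at this
  exact this

end MatrixCalculus

/-! ### From extended unitons to the equation in `μ`, and the strict inequality of ranks. -/

section Uniton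

open scoped Matrix.Norms.L2Operator

variable {n k : ℕ} {φ : ℝ × ℝ → ℂ → Mat n} {π : ℕ → ℝ × ℝ → Mat n}

theorem simpleProd_eq_projProd {p : ℝ × ℝ} (l : ℕ) (ζ : ℂ) :
    simpleProd Complex.I (fun j => π j p) l ζ =
      projProd π l ((ζ + Complex.I) / (ζ - Complex.I)) p := by
  induction l with
  | zero => rfl
  | succ l ih => simp [simpleProd, projProd, simpleElement, ih]

theorem isExtendedUniton_continuous (hφ : IsExtendedUniton k φ) {ζ : ℂ} (h1 : ζ ≠ Complex.I)
    (h2 : ζ ≠ -Complex.I) : Continuous fun p => φ p ζ := by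
  refine continuous_matrix fun a b => ?_
  have := (hφ.extendedSolution.smooth a b).continuousOn
  have hg : Continuous fun p : ℝ × ℝ => (((p.1, p.2, 0) : SpaceTime), ζ) := by fun_prop
  exact this.comp_continuous hg fun p => by simp [h1, h2]

theorem isLax_of_isExtendedUniton (hφ : IsExtendedUniton k φ) (hπ : ∀ j, ContDiff ℝ ∞ (π j))
    (hd : Dense {p | ∀ ζ, ζ ≠ Complex.I →
      φ p ζ = simpleProd Complex.I (fun j => π j p) k ζ}) : ∃ P, IsLax π k P := by
  obtain ⟨A, B, hAB⟩ := hφ.extendedSolution.lax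
  -- Without `t`-dependence, the first equation plus `i` times the second reads `(λ - i)(φ_x - iφ_y)
  -- = (A + iB)φ`, and `(λ - i)⁻¹ = (μ - 1)/(2i)`.
  refine ⟨fun p => (2 * Complex.I)⁻¹ • (A (p.1, p.2, 0) + Complex.I • B (p.1, p.2, 0)),
    fun μ p => ?_⟩
  have c1 := continuous_wirt_projProd hπ (-Complex.I) k p
  have c2 := continuous_projProd (π := π) k p
  -- The excluded values `μ = 0` and `μ = 1` correspond to `λ = -i` and `λ = ∞`.
  refine eq_of_forall_ne_ne (f := fun μ => wirt (-Complex.I) (projProd π k μ) p)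
    (g := fun μ => (μ - 1) • ((2 * Complex.I)⁻¹ • (A (p.1, p.2, 0) + Complex.I • B (p.1, p.2, 0)) *
      projProd π k μ p)) c1 (by fun_prop) 0 1 (fun μ h0 h1 => ?_) μ
  have h1' : μ - 1 ≠ 0 := sub_ne_zero.2 h1
  have hI := Complex.I_ne_zero
  set ζ : ℂ := Complex.I * (μ + 1) / (μ - 1) with hζ
  have e1 : ζ - Complex.I = 2 * Complex.I / (μ - 1) := by rw [hζ]; field_simp; ring
  have e2 : ζ + Complex.I = 2 * Complex.I * μ / (μ - 1) := by rw [hζ]; field_simp; ring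
  have n1 : ζ - Complex.I ≠ 0 := by rw [e1]; exact div_ne_zero (mul_ne_zero two_ne_zero hI) h1'
  have n2 : ζ + Complex.I ≠ 0 := by
    rw [e2]
    exact div_ne_zero (mul_ne_zero (mul_ne_zero two_ne_zero hI) h0) h1'
  have e3 : (ζ + Complex.I) / (ζ - Complex.I) = μ := by rw [e1, e2]; field_simp
  have m1 : ζ ≠ Complex.I := sub_ne_zero.1 n1
  have m2 : ζ ≠ -Complex.I := fun h => n2 (by rw [h]; ring)
  have hFd := contDiff_projProd hπ k μ
  have hF : ∀ q, φ q ζ = projProd π k μ q := by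
    refine congr_fun (Continuous.ext_on hd (isExtendedUniton_continuous hφ m1 m2) hFd.continuous
      fun q hq => ?_)
    rw [hq ζ m1, simpleProd_eq_projProd, e3]
  obtain ⟨l1, l2⟩ := hAB (p.1, p.2, 0) ζ (by simp [m1, m2])
  simp only [hF, dirDeriv_plane (hFd.differentiable (by simp))] at l1 l2
  have v1 : (ex.1, ex.2.1) = ((1, 0) : ℝ × ℝ) := rfl
  have v2 : (eu.1, eu.2.1) = ((0, 1) : ℝ × ℝ) := by simp [eu, et, ey]
  have v3 : (ev.1, ev.2.1) = -((0, 1) : ℝ × ℝ) := by simp [ev, et, ey]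
  rw [v1, v2] at l1
  rw [v1, v3, map_neg] at l2
  simp only [wirt, Prod.mk.eta] at *
  generalize fderiv ℝ (projProd π k μ) p (1, 0) = X at *
  generalize fderiv ℝ (projProd π k μ) p (0, 1) = Y at *
  have e4 : (μ - 1) * (2 * Complex.I)⁻¹ = (ζ - Complex.I)⁻¹ := by rw [e1]; field_simp
  rw [smul_mul_assoc, smul_smul, e4, eq_inv_smul_iff₀ n1, add_mul, smul_mul_assoc, ← l1, ← l2]
  simp only [sub_smul, sub_mul, smul_add, smul_sub, smul_neg, neg_smul, smul_smul, Complex.I_mul_I,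
    one_smul, mul_comm Complex.I ζ]
  abel

/-- Induction on the number of factors: `π_{m+1}` is a right multiple of `π_{m+1} π_m`, and `π_m` is
one of `π_m ⋯ π_1`. The second claim is the adjoint of the first. -/
theorem exists_factor (hpr : ∀ j p, IsHermitianProjection (π j p)) {p : ℝ × ℝ}
    (hp : ∀ j ∈ Set.Icc 2 k, im (π j p) ⊓ im (1 - π (j - 1) p) = ⊥) {l : ℕ}
    (hl : l ∈ Set.Icc 1 k) :
    (∃ Y, projProd π l 0 p * Y = π l p) ∧ ∃ Y, Y * projProdRev π l 0 p = π l p := by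
  have key : ∀ m, m + 1 ≤ k → ∃ Y, projProd π (m + 1) 0 p * Y = π (m + 1) p := fun m hm => by
    induction m with
    | zero => exact ⟨1, by simp [projProd]⟩
    | succ m ih =>
      obtain ⟨Y, hY⟩ := ih (by omega)
      obtain ⟨Z, hZ⟩ := exists_mul_mul_eq (hpr _ p) (hpr _ p) (hp (m + 1 + 1) ⟨by omega, hm⟩)
      refine ⟨Y * Z, ?_⟩
      rw [projProd_zero_succ, mul_assoc, ← mul_assoc _ Y, hY, ← mul_assoc]
      exact hZ
  obtain ⟨m, rfl⟩ : ∃ m, l = m + 1 := ⟨l - 1, by have := hl.1; omega⟩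
  obtain ⟨Y, hY⟩ := key m hl.2
  refine ⟨⟨Y, hY⟩, star Y, ?_⟩
  have := congr_arg star hY
  rwa [star_mul, star_projProd (fun j q => (hpr j q).1), map_zero,
    (hpr _ p).1.isSelfAdjoint.star_eq] at this

/-- Consecutive ranks are different where the factorization is minimal. -/
theorem rank_ne_of_isExtendedUniton (hφ : IsExtendedUniton k φ) (hπ : ∀ j, ContDiff ℝ ∞ (π j))
    (hpr : ∀ j p, IsHermitianProjection (π j p))
    (hmin : Dense {p | IsMinimalFactorization Complex.I k k (fun j => π j p) (φ p)})
    (hconst : ∀ c : Fin n → ℂ, (∀ p, c ∈ im (π 1 p)) → c = 0) {l : ℕ} (hl : 1 ≤ l)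
    (hlk : l + 1 ≤ k) {p₀ : ℝ × ℝ}
    (hp₀ : IsMinimalFactorization Complex.I k k (fun j => π j p₀) (φ p₀)) :
    (π (l + 1) p₀).rank ≠ (π l p₀).rank := by
  intro hr
  have hid : ∀ j p, π j p * π j p = π j p := fun j p => (hpr j p).2
  have hsa : ∀ j p, star (π j p) = π j p := fun j p => (hpr j p).1
  obtain ⟨P, hP⟩ := isLax_of_isExtendedUniton hφ hπ
    (hmin.mono fun p hp ζ hζ => by simpa using hp.eq_prod ζ hζ)
  have hD : ∀ i ∈ Set.Icc 1 k, DenseFactor π i := fun i hi =>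
    hmin.mono fun p hp => exists_factor hpr hp.inf_eq_bot hi
  have hG := isUnit_of_rank_eq (hpr (l + 1) p₀) (hpr l p₀)
    (hp₀.inf_eq_bot (l + 1) ⟨by omega, hlk⟩) hr
  have hR := hP.mul_projProdRev_eq hπ hid hsa hD hl hlk hG
  have hzero : projProdRev π l 0 p₀ = 0 := by
    have hcol : ∀ b, (projProdRev π l 0 p₀).col b = 0 := fun b => hconst _ fun p => by
      rw [mem_im_iff (hid 1 p)]
      conv_rhs => rw [← hR p]
      rfl
    ext a b
    exact congr_fun (hcol b) a
  obtain ⟨-, Y, hY⟩ := exists_factor hpr hp₀.inf_eq_bot (l := l) ⟨hl, by omega⟩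
  rw [hzero, mul_zero] at hY
  exact (hp₀.proj l ⟨hl, by omega⟩).2.1 hY.symm

end Uniton

/-! ### Reduction to sequences of projections indexed by all natural numbers. -/

section MainResult

open scoped Matrix.Norms.L2Operator

variable {n k : ℕ} {φ : ℝ × ℝ → ℂ → Mat n} {π : ℕ → ℝ × ℝ → Mat n}

theorem simpleProd_congr {z ζ : ℂ} {P Q : ℕ → Mat n} {l : ℕ} (h : ∀ j ∈ Set.Icc 1 l, P j = Q j) :
    simpleProd z P l ζ = simpleProd z Q l ζ := by
  induction l with
  | zero => rfl
  | succ l ih =>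
    rw [simpleProd, simpleProd, h (l + 1) ⟨by omega, le_rfl⟩,
      ih fun j hj => h j ⟨hj.1, hj.2.trans (Nat.le_succ l)⟩]

theorem IsMinimalFactorization.congr {z : ℂ} {l : ℕ} {P Q : ℕ → Mat n} {f : ℂ → Mat n}
    (hP : IsMinimalFactorization z k l P f) (h : ∀ j ∈ Set.Icc 1 l, P j = Q j) :
    IsMinimalFactorization z k l Q f where
  le := hP.le
  proj j hj := h j hj ▸ hP.proj j hj
  inf_eq_bot j hj := by
    obtain ⟨h1, h2⟩ := hj
    rw [← h j ⟨by omega, h2⟩, ← h (j - 1) ⟨by omega, by omega⟩]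
    exact hP.inf_eq_bot j ⟨h1, h2⟩
  eq_prod ζ hζ := by rw [← simpleProd_congr h]; exact hP.eq_prod ζ hζ

theorem rank_strictAntiOn (hφ : IsExtendedUniton k φ)
    (hπ : IsMinimalFactorizationMap Complex.I k π φ)
    (hconst : ∀ c : Fin n → ℂ, (∀ p, c ∈ im (π 1 p)) → c = 0) :
    ∃ m : ℕ → ℕ, (∀ j ∈ Set.Icc 1 k, ∀ p, (π j p).rank = m j) ∧
      StrictAntiOn m (Set.Icc 1 k) := by
  classical
  -- Smoothness and the projection property are known only for `1 ≤ j ≤ k`, whereas the lemmas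
  -- require them for all `j`; the constant `1` is a harmless filler.
  set ρ : ℕ → ℝ × ℝ → Mat n := fun j p => if j ∈ Set.Icc 1 k then π j p else 1 with hρ
  have hρπ : ∀ j ∈ Set.Icc 1 k, ρ j = π j := fun j hj => by
    funext p
    simp only [hρ, if_pos hj]
  have hρ1 : ∀ j, j ∉ Set.Icc 1 k → ρ j = fun _ => 1 := fun j hj => by
    funext p
    simp only [hρ, if_neg hj]
  have hsm : ∀ j, ContDiff ℝ ∞ (ρ j) := fun j => by
    by_cases hj : j ∈ Set.Icc 1 k
    · rw [hρπ j hj]; exact contDiff_of_entries (hπ.smooth j hj)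
    · rw [hρ1 j hj]; exact contDiff_const
  have hpr : ∀ j p, IsHermitianProjection (ρ j p) := fun j p => by
    by_cases hj : j ∈ Set.Icc 1 k
    · rw [hρπ j hj]; exact hπ.proj j hj p
    · rw [hρ1 j hj]; exact ⟨Matrix.isHermitian_one, mul_one 1⟩
  have hmin : Dense {p | IsMinimalFactorization Complex.I k k (fun j => ρ j p) (φ p)} :=
    hπ.minimal.mono fun p hp => hp.congr fun j hj => (congr_fun (hρπ j hj) p).symm
  obtain ⟨p₀, hp₀⟩ := hmin.nonempty
  have hrank : ∀ j p, (ρ j p).rank = (ρ j p₀).rank := fun j p =>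
    rank_eq_of_continuous (hsm j).continuous (fun q => (hpr j q).2) p p₀
  refine ⟨fun j => (ρ j p₀).rank, fun j hj p => ?_, ?_⟩
  · rw [← hρπ j hj]
    exact hrank j p
  · refine strictAntiOn_of_add_one_lt Set.ordConnected_Icc fun l _ hl hl' => ?_
    refine lt_of_le_of_ne (rank_le_of_inf_eq_bot (hpr _ _) (hpr _ _)
      (hp₀.inf_eq_bot (l + 1) ⟨by have := hl.1; omega, hl'.2⟩)) ?_
    refine rank_ne_of_isExtendedUniton hφ hsm hpr hmin (fun c hc => hconst c fun p => ?_) hl.1 hl'.2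
      hp₀
    rw [← hρπ 1 ⟨le_rfl, hl.1.trans hl.2⟩]
    exact hc p

end MainResult

end Ward

end

theorem mainTheorem10 (n k : ℕ) (φ : ℝ × ℝ → ℂ → Ward.Mat n) (π : ℕ → ℝ × ℝ → Ward.Mat n)
    (hφ : Ward.IsExtendedUniton k φ)
    (hπ : Ward.IsMinimalFactorizationMap Complex.I k π φ)
    (hconst : ∀ c : Fin n → ℂ, (∀ p, c ∈ Ward.im (π 1 p)) → c = 0) :
    ∃ m : ℕ → ℕ, (∀ j ∈ Set.Icc 1 k, ∀ p, (π j p).rank = m j) ∧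
      StrictAntiOn m (Set.Icc 1 k) :=
  Ward.rank_strictAntiOn hφ hπ hconst
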